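/- \textbf{Setting.} A domain over $\mathbb{R}^n$ is a pair $D=(D_{in},D_{out})$ of Borel probability measures on $\mathbb{R}^n$; a domain space is a set $\mathcal{D}$ of domains, and it satisfies an assumption if all its domains do. The support $\mathrm{supp}(\mu)$ is the set of points all of whose neighbourhoods have positive $\mu$-mass. For $\gamma>0$, $C\ge 0$, $R>0$: \begin{itemize} \item DSA: $\mathrm{supp}(D_{in})\cap\mathrm{supp}(D_{out})=\emptyset$; \item BoundedID for $R$: $\mathrm{diam}(\mathrm{supp}(D_{in}))<R$; \item $(\gamma,C)$-ID-H\"older (resp. $(\gamma,C)$-OOD-H\"older): $D_{in}$ (resp. $D_{out}$) has a Lebesgue density $f:\mathbb{R}^n\to[0,\infty)$ with $|f(x)-f(y)|\le C\|x-y\|^\gamma$ for all $x,y\in\mathbb{R}^n$. \end{itemize} A hypothesis is a set $h\subseteq\mathbb{R}^n$ (the points predicted to be in-distribution). For a fixed OOD probability $\alpha\in(0,1)$ its risk is $R^\alpha_D(h)=(1-\alpha)D_{in}(\mathbb{R}^n\setminus h)+\alpha D_{out}(h)$ (outer measures if $h$ is not measurable). OOD detection is uniformly learnable for $\mathcal{D}$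 in $\mathcal{H}\subseteq\mathcal{P}(\mathbb{R}^n)$ if there are a function $N:(0,1/2)^2\to\mathbb{N}$ and a (possibly randomized) learning algorithm $\mathcal{A}$, which may depend on $\mathcal{D}$, $\mathcal{H}$ and $\alpha$, such that for all $\epsilon,\delta\in(0,1/2)$ and all $D\in\mathcal{D}$: given $\epsilon$, $\delta$ and access to independent samples from $D_{in}$, $\mathcal{A}$ draws at most $N(\epsilon,\delta)$ samples and outputs some $h\in\mathcal{H}$, and with probability at least $1-\delta$ over the samples and the internal randomness, $R^\alpha_D(h)\le\inf_{h'\in\mathcal{H}}R^\alpha_D(h')+\epsilon$. (An algorithm is an arbitrary, possibly adaptive, decision rule; if the success event is not measurable, it is required to contain a measurable event of probability at least $1-\delta$.) \textbf{Theorem (Uniform OOD Detection under H\"older).} Let $n\in\mathbb{N}$, $\alpha\in(0,1)$, $\gamma>0$ and $C\ge 0$. \begin{enumerate} \item Let $R>0$ and let $\mathcal{D}$ be a domain space over $\mathbb{R}^n$ that satisfies DSA, BoundedID for $R$, and the $(\gamma,C)$-ID-H\"older assumption (or the $(\gamma,C)$-OOD-H\"older assumption). Then OOD detection is uniformly learnable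 for $\mathcal{D}$ in $\mathcal{P}(\mathbb{R}^n)$. \item Suppose in addition that $n\ge 1$, $\gamma\le 1$ and $C>0$. Let $\mathcal{D}_{H^{ID}_{\gamma,C}}$ (resp. $\mathcal{D}_{H^{OOD}_{\gamma,C}}$) be the space of all domains over $\mathbb{R}^n$ that satisfy DSA and the $(\gamma,C)$-ID-H\"older (resp. $(\gamma,C)$-OOD-H\"older) assumption. Then OOD detection is uniformly learnable in $\mathcal{P}(\mathbb{R}^n)$ neither for $\mathcal{D}_{H^{ID}_{\gamma,C}}$ nor for $\mathcal{D}_{H^{OOD}_{\gamma,C}}$. \end{enumerate} -/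

import Mathlib

open MeasureTheory
open scoped NNReal ENNReal

namespace OODDetection

/-- A domain over `X`: a pair consisting of an in-distribution (ID) and an out-of-distribution
(OOD) probability measure on `X`. A domain space over `X` is a term of `Set (Domain X)`. -/
structure Domain (X : Type*) [MeasurableSpace X] where
  /-- the ID distribution -/
  inDist : Measure X
  /-- the OOD distribution -/
  outDist : Measure X
  isProb_in : IsProbabilityMeasure inDist
  isProb_out : IsProbabilityMeasure outDist

attribute [instance] Domain.isProb_in Domain.isProb_out

namespace Domain

section Risk

variable {X : Type*} [MeasurableSpace X]

/-- ID risk of the hypothesis `h ⊆ X` (the points of `h` are predicted to be ID): the `inDist`-mass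
of the points that `h` rejects. For a non-measurable `h` this is the outer measure. -/
noncomputable def riskIn (D : Domain X) (h : Set X) : ℝ := D.inDist.real hᶜ

/-- OOD risk of the hypothesis `h ⊆ X`: the `outDist`-mass of the points that `h` accepts.
For a non-measurable `h` this is the outer measure. -/
noncomputable def riskOut (D : Domain X) (h : Set X) : ℝ := D.outDist.real h

/-- The 0-1 risk of `h` when the OOD probability is `α`. -/
noncomputable def risk (α : ℝ) (D : Domain X) (h : Set X) : ℝ :=
  (1 - α) * D.riskIn h + α * D.riskOut h

end Risk

/-- Disjoint Supports Assumption (DSA). -/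
def DisjointSupports {X : Type*} [TopologicalSpace X] [MeasurableSpace X] (D : Domain X) : Prop :=
  Disjoint D.inDist.support D.outDist.support

/-- Bounded ID Support Assumption (BoundedID) for `R`. The diameter is the extended one, so that
an unbounded support has diameter `∞`. -/
def BoundedID {X : Type*} [PseudoEMetricSpace X] [MeasurableSpace X] (R : ℝ) (D : Domain X) :
    Prop :=
  Metric.ediam D.inDist.support < ENNReal.ofReal R

end Domain

/-- The measure `μ` on `ℝⁿ` has a density with respect to Lebesgue measure that is
`(γ, C)`-Hölder continuous on the whole of `ℝⁿ`. -/
def HasHolderDensity {n : ℕ} (γ C : ℝ≥0) (μ : Measure (EuclideanSpace ℝ (Fin n))) : Prop :=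
  ∃ f : EuclideanSpace ℝ (Fin n) → ℝ, (∀ x, 0 ≤ f x) ∧ HolderWith C γ f ∧
    μ = volume.withDensity (fun x => ENNReal.ofReal (f x))

/-- `(γ, C)`-Hölder-continuous ID Distribution Assumption. -/
def Domain.IDHolder {n : ℕ} (γ C : ℝ≥0) (D : Domain (EuclideanSpace ℝ (Fin n))) : Prop :=
  HasHolderDensity γ C D.inDist

/-- `(γ, C)`-Hölder-continuous OOD Distribution Assumption. -/
def Domain.OODHolder {n : ℕ} (γ C : ℝ≥0) (D : Domain (EuclideanSpace ℝ (Fin n))) : Prop :=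
  HasHolderDensity γ C D.outDist

/-- The domain space of all domains over `ℝⁿ` satisfying DSA and `(γ, C)`-ID-Hölder. -/
def idHolderSpace (n : ℕ) (γ C : ℝ≥0) : Set (Domain (EuclideanSpace ℝ (Fin n))) :=
  {D | D.DisjointSupports ∧ D.IDHolder γ C}

/-- The domain space of all domains over `ℝⁿ` satisfying DSA and `(γ, C)`-OOD-Hölder. -/
def oodHolderSpace (n : ℕ) (γ C : ℝ≥0) : Set (Domain (EuclideanSpace ℝ (Fin n))) :=
  {D | D.DisjointSupports ∧ D.OODHolder γ C}

/-- A (possibly randomized) learning algorithm over the instance space `X`. Its internal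
randomization is a random seed, drawn from an arbitrary probability space independently of the
samples. Given `ε`, `δ`, the seed and the list of the samples drawn so far, the algorithm either
calls the example oracle once more (`none`) or stops and outputs a hypothesis (`some h`). -/
structure Learner (X : Type*) where
  Seed : Type
  mSeed : MeasurableSpace Seed
  seedDist : Measure Seed
  isProb_seed : IsProbabilityMeasure seedDist
  step : (ε δ : ℝ) → Seed → List X → Option (Set X)

attribute [instance] Learner.mSeed Learner.isProb_seed

/-- On inputs `ε`, `δ`, with seed `ω` and when the successive answers of the oracle are the members
of the list `xs`, the algorithm stops after at most `xs.length` oracle calls and outputs `h`. -/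
def Learner.Outputs {X : Type*} (A : Learner X) (ε δ : ℝ) (ω : A.Seed) (xs : List X)
    (h : Set X) : Prop :=
  ∃ k ≤ xs.length, A.step ε δ ω (xs.take k) = some h ∧
    ∀ j < k, A.step ε δ ω (xs.take j) = none

/-- Uniform learnability of OOD detection for the domain space `𝒟` in the hypothesis space `ℋ`,
with OOD probability `α`: some algorithm always stops after at most `N ε δ` oracle calls, outputs
a hypothesis from `ℋ`, and its risk exceeds the infimum over `ℋ` by more than `ε` with probability
at most `δ`, over the seed and the i.i.d. samples from the ID distribution. (If the failure event
is not measurable, its outer measure has to be at most `δ`, that is, success contains a measurable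
event of probability at least `1 - δ`.) -/
def UniformlyLearnable {X : Type*} [MeasurableSpace X] (α : ℝ) (𝒟 : Set (Domain X))
    (ℋ : Set (Set X)) : Prop :=
  ∃ (N : ℝ → ℝ → ℕ) (A : Learner X),
    ∀ ε ∈ Set.Ioo (0 : ℝ) (1 / 2), ∀ δ ∈ Set.Ioo (0 : ℝ) (1 / 2), ∀ D ∈ 𝒟,
      (∀ (ω : A.Seed) (x : Fin (N ε δ) → X), ∃ h ∈ ℋ, A.Outputs ε δ ω (List.ofFn x) h) ∧
      (A.seedDist.prod (Measure.pi fun _ : Fin (N ε δ) => D.inDist))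
        {p | ∃ h, A.Outputs ε δ p.1 (List.ofFn p.2) h ∧
          (⨅ h' : ℋ, D.risk α h') + ε < D.risk α h} ≤ ENNReal.ofReal δ

end OODDetection

namespace OODDetection

open ProbabilityTheory

/-! ### Learning by thresholding empirical masses on a countable partition -/

section Upper

variable {X : Type*} [MeasurableSpace X]

/-! Positive part: cut `ℝⁿ` into cubes of mesh `s` and accept the cubes whose empirical mass is at
least `2t`, where `t = c * s ^ n`. Chebyshev's inequality bounds the failure probability on one cube
by its mass over `m * t ^ 2`; since the masses add up to `1`, the union bound costs nothing, even
over infinitely many cubes. So, with high probability, accepted cubes have mass above `t` and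
rejected ones below `3t`. Rejected cubes that meet the bounded ID support fill at most a fixed ball,
so their mass is `O(c)`. If the ID density is Hölder, an accepted cube has a point with density
above `c`, hence lies in the ID support, and OOD mass there is zero. If the OOD density is Hölder,
an accepted cube meets the ID support, where the OOD density vanishes, so this density is at most
`c` on the cube. `uniformlyLearnable_of_boundedID` combines these estimates.

Negative part: without boundedness, mass can be spread over `M` far-apart pairs of cones, one member
of each pair being ID and the other OOD. Averaging over `M` cones makes the Hölder constant as small
as desired. A learner with `N ≤ M / 2` samples sees at most half of the pairs; exchanging the roles
in all unseen pairs leaves the sample law unchanged, yet no hypothesis is good before and after the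
exchange (`sum_risk_lower_bound`). Averaging over all choices gives failure probability at least
`1/2` for some domain (`not_uniformlyLearnable_of_pairs`). -/

theorem Domain.risk_nonneg {α : ℝ} (hα : α ∈ Set.Ioo (0 : ℝ) 1) (D : Domain X) (h : Set X) :
    0 ≤ D.risk α h :=
  add_nonneg (mul_nonneg (by linarith [hα.2]) measureReal_nonneg)
    (mul_nonneg hα.1.le measureReal_nonneg)

theorem Domain.iInf_risk_nonneg {α : ℝ} (hα : α ∈ Set.Ioo (0 : ℝ) 1) (D : Domain X)
    (ℋ : Set (Set X)) : 0 ≤ ⨅ h : ℋ, D.risk α h :=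
  Real.iInf_nonneg fun h => D.risk_nonneg hα h

/-- The fraction of the members of the list `xs` that lie in `s`. -/
noncomputable def empMass (xs : List X) (s : Set X) : ℝ :=
  (xs.map (s.indicator 1)).sum / xs.length

omit [MeasurableSpace X] in
theorem empMass_ofFn {m : ℕ} (x : Fin m → X) (s : Set X) :
    empMass (List.ofFn x) s = (m : ℝ)⁻¹ * ∑ i, s.indicator (1 : X → ℝ) (x i) := by
  simp [empMass, List.map_ofFn, List.sum_ofFn, div_eq_inv_mul]

theorem memLp_indicator_one (μ : Measure X) [IsProbabilityMeasure μ] {s : Set X}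
    (hs : MeasurableSet s) : MemLp (s.indicator (1 : X → ℝ)) 2 μ :=
  (memLp_const (1 : ℝ)).indicator hs

theorem variance_indicator_one_le (μ : Measure X) [IsProbabilityMeasure μ] {s : Set X}
    (hs : MeasurableSet s) : Var[s.indicator (1 : X → ℝ); μ] ≤ μ.real s := by
  refine (variance_le_expectation_sq (memLp_indicator_one μ hs).1).trans_eq ?_
  have : (s.indicator (1 : X → ℝ)) ^ 2 = s.indicator 1 := by
    ext x
    by_cases hx : x ∈ s <;> simp [hx]
  rw [this, integral_indicator_one hs]

/-- Chebyshev's inequality for the empirical mass of one set. -/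
theorem measure_le_abs_empMass_sub_le (μ : Measure X) [IsProbabilityMeasure μ] {s : Set X}
    (hs : MeasurableSet s) {m : ℕ} (hm : 0 < m) {t : ℝ} (ht : 0 < t) :
    Measure.pi (fun _ : Fin m => μ) {x | t ≤ |empMass (List.ofFn x) s - μ.real s|} ≤
      ENNReal.ofReal (1 / (m * t ^ 2)) * μ s := by
  have hm' : (0 : ℝ) < m := by exact_mod_cast hm
  set P := Measure.pi (fun _ : Fin m => μ)
  set Y : Fin m → (Fin m → X) → ℝ := fun i x => s.indicator (1 : X → ℝ) (x i)
  have hY : ∀ i, MemLp (Y i) 2 P := fun i =>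
    (memLp_indicator_one μ hs).comp_measurePreserving (measurePreserving_eval (fun _ => μ) i)
  have hEY : ∀ i, ∫ x, Y i x ∂P = μ.real s := fun i => by
    have := integral_comp_eval (μ := fun _ : Fin m => μ) (i := i)
      (f := s.indicator (1 : X → ℝ)) (memLp_indicator_one μ hs).1
    rw [integral_indicator_one hs] at this
    exact this
  have hE : ∫ x, (m : ℝ)⁻¹ * ∑ i, Y i x ∂P = μ.real s := by
    rw [integral_const_mul, integral_finsetSum _ fun i _ => (hY i).integrable one_le_two]
    simp [hEY]
    field_simp
  -- The bound retains the factor `μ s`, so that it can be summed over disjoint sets.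
  have hV : Var[fun x => (m : ℝ)⁻¹ * ∑ i, Y i x; P] ≤ μ.real s / m := by
    rw [variance_const_mul]
    have h1 : Var[fun x => ∑ i, Y i x; P] = ∑ _i : Fin m, Var[s.indicator (1 : X → ℝ); μ] := by
      have := variance_sum_pi (μ := fun _ : Fin m => μ) (X := fun _ => s.indicator (1 : X → ℝ))
        (fun _ => memLp_indicator_one μ hs)
      rw [← this]
      congr 1
      ext x
      simp [Y]
    rw [h1]
    simp only [Finset.sum_const, Finset.card_univ, Fintype.card_fin, nsmul_eq_mul]
    have := variance_indicator_one_le μ hs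
    calc (m : ℝ)⁻¹ ^ 2 * (m * Var[s.indicator (1 : X → ℝ); μ])
        ≤ (m : ℝ)⁻¹ ^ 2 * (m * μ.real s) := by gcongr
      _ = μ.real s / m := by field_simp
  have hL : MemLp (fun x => (m : ℝ)⁻¹ * ∑ i, Y i x) 2 P :=
    (memLp_finsetSum _ fun i _ => hY i).const_mul _
  have key := meas_ge_le_variance_div_sq hL ht
  rw [hE] at key
  simp only [empMass_ofFn]
  refine key.trans ?_
  rw [← ofReal_measureReal (μ := μ) (s := s), ← ENNReal.ofReal_mul (by positivity)]
  refine ENNReal.ofReal_le_ofReal ?_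
  calc _ ≤ μ.real s / m / t ^ 2 := by gcongr
    _ = _ := by field_simp

/-- The empirical masses of the cells of a countable measurable partition are uniformly close to
the true masses, with a bound that does not depend on the number of cells. -/
theorem measure_exists_le_abs_empMass_sub_le {ι : Type*} [Countable ι] [MeasurableSpace ι]
    [MeasurableSingletonClass ι] (μ : Measure X) [IsProbabilityMeasure μ] {φ : X → ι}
    (hφ : Measurable φ) {m : ℕ} (hm : 0 < m) {t : ℝ} (ht : 0 < t) :
    Measure.pi (fun _ : Fin m => μ)
      {x | ∃ k, t ≤ |empMass (List.ofFn x) (φ ⁻¹' {k}) - μ.real (φ ⁻¹' {k})|} ≤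
      ENNReal.ofReal (1 / (m * t ^ 2)) := by
  rw [Set.ofPred_exists]
  have hs : ∀ k, MeasurableSet (φ ⁻¹' {k}) := fun k => hφ (measurableSet_singleton k)
  calc _ ≤ ∑' k, Measure.pi (fun _ : Fin m => μ)
        {x | t ≤ |empMass (List.ofFn x) (φ ⁻¹' {k}) - μ.real (φ ⁻¹' {k})|} :=
        measure_iUnion_le _
    _ ≤ ∑' k, ENNReal.ofReal (1 / (m * t ^ 2)) * μ (φ ⁻¹' {k}) :=
        ENNReal.tsum_le_tsum fun k => measure_le_abs_empMass_sub_le μ (hs k) hm ht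
    _ = ENNReal.ofReal (1 / (m * t ^ 2)) := by
        rw [ENNReal.tsum_mul_left, ← measure_iUnion _ hs]
        · have : ⋃ k, φ ⁻¹' {k} = Set.univ := by ext x; simp
          rw [this, measure_univ, mul_one]
        · intro i j hij
          exact Disjoint.preimage _ (by simpa using hij)

/-- The learner that draws `m ε δ` samples and accepts the cells of the partition `φ ε` whose
empirical mass is at least `2 * t ε`. -/
noncomputable def binLearner {ι : Type*} (φ : ℝ → X → ι) (m : ℝ → ℝ → ℕ) (t : ℝ → ℝ) :
    Learner X where
  Seed := Unit
  mSeed := inferInstance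
  seedDist := Measure.dirac ()
  isProb_seed := inferInstance
  step ε δ _ xs :=
    if xs.length = m ε δ then some {x | 2 * t ε ≤ empMass xs (φ ε ⁻¹' {φ ε x})} else none

omit [MeasurableSpace X] in
theorem binLearner_outputs_iff {ι : Type*} (φ : ℝ → X → ι) (m : ℝ → ℝ → ℕ) (t : ℝ → ℝ)
    (ε δ : ℝ) (ω : Unit) (x : Fin (m ε δ) → X) (h : Set X) :
    (binLearner φ m t).Outputs ε δ ω (List.ofFn x) h ↔
      h = {y | 2 * t ε ≤ empMass (List.ofFn x) (φ ε ⁻¹' {φ ε y})} := by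
  constructor
  · rintro ⟨k, hk, hs, -⟩
    rw [List.length_ofFn] at hk
    by_cases hkm : k = m ε δ
    · have : (List.ofFn x).take k = List.ofFn x := List.take_of_length_le (by simp [hkm])
      rw [this] at hs
      simpa [binLearner, eq_comm] using hs
    · simp [binLearner, min_eq_left hk, hkm] at hs
  · rintro rfl
    refine ⟨m ε δ, by simp, ?_, fun j hj => ?_⟩
    · rw [List.take_of_length_le (by simp)]
      simp [binLearner]
    · simp [binLearner, hj.le, hj.ne]

/-- Isolates the deterministic condition `H`: cutting at `2t` with empirical masses accurate to
within `t` separates cells of mass at most `t` from those of mass at least `3t`. Risk at most `ε` is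
enough because the infimum is nonnegative. -/
theorem uniformlyLearnable_of_partition {ι : Type*} [Countable ι] [MeasurableSpace ι]
    [MeasurableSingletonClass ι] {α : ℝ} (hα : α ∈ Set.Ioo (0 : ℝ) 1) (𝒟 : Set (Domain X))
    (φ : ℝ → X → ι) (t : ℝ → ℝ) (hφ : ∀ ε, Measurable (φ ε)) (ht : ∀ ε, 0 < ε → 0 < t ε)
    (H : ∀ ε, 0 < ε → ∀ D ∈ 𝒟, ∀ h : Set X,
      (∀ x ∈ h, t ε < D.inDist.real (φ ε ⁻¹' {φ ε x})) →
      (∀ x ∉ h, D.inDist.real (φ ε ⁻¹' {φ ε x}) < 3 * t ε) → D.risk α h ≤ ε) :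
    UniformlyLearnable α 𝒟 Set.univ := by
  set m : ℝ → ℝ → ℕ := fun ε δ => ⌈1 / (δ * t ε ^ 2)⌉₊
  refine ⟨m, binLearner φ m t, fun ε hε δ hδ D hD => ⟨fun ω x =>
    ⟨_, Set.mem_univ _, (binLearner_outputs_iff φ m t ε δ ω x _).2 rfl⟩, ?_⟩⟩
  have ht' := ht ε hε.1
  have hpos : 0 < 1 / (δ * t ε ^ 2) := by have := hδ.1; positivity
  have hm : 0 < m ε δ := Nat.ceil_pos.2 hpos
  have hm' : (0 : ℝ) < m ε δ := by exact_mod_cast hm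
  set P := Measure.pi fun _ : Fin (m ε δ) => D.inDist
  set B : Set (Fin (m ε δ) → X) := {x | ∃ k, t ε ≤
    |empMass (List.ofFn x) (φ ε ⁻¹' {k}) - D.inDist.real (φ ε ⁻¹' {k})|}
  have hB : P B ≤ ENNReal.ofReal δ := by
    refine (measure_exists_le_abs_empMass_sub_le D.inDist (hφ ε) hm ht').trans
      (ENNReal.ofReal_le_ofReal ?_)
    have h1 : 1 / (δ * t ε ^ 2) ≤ m ε δ := Nat.le_ceil _
    have hδ' := hδ.1
    rw [div_le_iff₀ (by positivity)] at h1 ⊢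
    nlinarith
  refine le_trans (measure_mono (t := Set.univ ×ˢ B) ?_) ?_
  · rintro ⟨ω, x⟩ ⟨h, hh, hr⟩
    have hh := (binLearner_outputs_iff φ m t ε δ ω x h).1 hh
    refine ⟨trivial, ?_⟩
    by_contra hxB
    simp only [B, Set.mem_ofPred_eq, not_exists, not_le, abs_lt] at hxB
    have := D.iInf_risk_nonneg hα Set.univ
    refine absurd (H ε hε.1 D hD h ?_ ?_) (by linarith)
    · intro y hy
      rw [hh] at hy
      have h1 := hxB (φ ε y)
      have h2 : 2 * t ε ≤ _ := hy
      linarith [h1.2]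
    · intro y hy
      rw [hh] at hy
      have h1 := hxB (φ ε y)
      have h2 : _ < 2 * t ε := not_le.1 hy
      linarith [h1.1]
  · change (Measure.prod _ P) _ ≤ _
    rw [Measure.prod_prod, measure_univ, one_mul]
    exact hB

end Upper

/-! ### Indistinguishable domains from pairs of measures -/

section Lower

/-- The ID support is itself a hypothesis of risk zero: in a hereditarily Lindelöf space the
complement of a support is null, and DSA puts the ID support inside the complement of the OOD
support. -/
theorem Domain.iInf_risk_univ_eq_zero {X : Type*} [TopologicalSpace X] [MeasurableSpace X]
    [HereditarilyLindelofSpace X] {α : ℝ} (hα : α ∈ Set.Ioo (0 : ℝ) 1) (D : Domain X)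
    (hD : D.DisjointSupports) : ⨅ h : (Set.univ : Set (Set X)), D.risk α h = 0 := by
  refine le_antisymm ?_ (D.iInf_risk_nonneg hα _)
  refine (ciInf_le ⟨0, by rintro _ ⟨h, rfl⟩; exact D.risk_nonneg hα h⟩ ⟨D.inDist.support, trivial⟩).trans_eq ?_
  have h1 : D.inDist D.inDist.supportᶜ = 0 := Measure.measure_compl_support
  have h2 : D.outDist D.inDist.support = 0 :=
    measure_mono_null hD.subset_compl_right Measure.measure_compl_support
  simp [Domain.risk, Domain.riskIn, Domain.riskOut, Measure.real, h1, h2]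

/-- A finite product of uniform mixtures is a uniform mixture of products. -/
theorem prod_pi_smul_sum {X S : Type*} [MeasurableSpace X] [MeasurableSpace S] (ρ : Measure S)
    [IsProbabilityMeasure ρ] {N M : ℕ} (hM : 0 < M) (ν : Fin M → Measure X)
    [∀ i, IsProbabilityMeasure (ν i)] :
    ρ.prod (Measure.pi fun _ : Fin N => (M : ℝ≥0∞)⁻¹ • ∑ i, ν i) =
      ((M : ℝ≥0∞)⁻¹ ^ N) • ∑ j : Fin N → Fin M, ρ.prod (Measure.pi fun k => ν (j k)) := by
  have : IsFiniteMeasure ((M : ℝ≥0∞)⁻¹ • ∑ i, ν i) :=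
    Measure.smul_finite _ (by simp [hM.ne'])
  refine Measure.prod_eq_generateFrom MeasurableSpace.generateFrom_measurableSet generateFrom_pi
    MeasurableSpace.isPiSystem_measurableSet isPiSystem_pi ρ.toFiniteSpanningSetsIn ?_ ?_
  · exact (Measure.FiniteSpanningSetsIn.pi fun _ => Measure.toFiniteSpanningSetsIn _)
  · rintro s hs _ ⟨u, hu, rfl⟩
    simp only [Measure.smul_apply, Measure.finsetSum_apply, Measure.prod_prod, Measure.pi_pi,
      smul_eq_mul, ← Finset.mul_sum]
    -- On rectangles the identity is the expansion of a product of sums over all index choices `j`.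
    rw [Finset.prod_mul_distrib, Finset.prod_univ_sum]
    simp only [Finset.prod_const, Finset.card_univ, Fintype.card_fin, Fintype.piFinset_univ]
    ring

/-- If the ID distributions of two domains use opposite members of at least half of the pairs, then
no hypothesis has small risk for both domains. -/
theorem sum_risk_lower_bound {X : Type*} [MeasurableSpace X] {α : ℝ}
    (hα : α ∈ Set.Ioo (0 : ℝ) 1) {M : ℕ} (hM : 0 < M) (ν : Fin M → Bool → Measure X)
    [∀ i b, IsProbabilityMeasure (ν i b)] (σ τ : Fin M → Bool) (D E : Domain X)
    (hD : D.inDist = (M : ℝ≥0∞)⁻¹ • ∑ i, ν i (σ i))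
    (hD' : D.outDist = (M : ℝ≥0∞)⁻¹ • ∑ i, ν i (!σ i))
    (hE : E.inDist = (M : ℝ≥0∞)⁻¹ • ∑ i, ν i (τ i))
    (hE' : E.outDist = (M : ℝ≥0∞)⁻¹ • ∑ i, ν i (!τ i))
    (J : Finset (Fin M)) (hJ : 2 * J.card ≤ M) (hτ : ∀ i ∉ J, τ i = !σ i) (h : Set X) :
    min α (1 - α) ≤ D.risk α h + E.risk α h := by
  have hsum : ∀ (κ : Fin M → Measure X) [∀ i, IsProbabilityMeasure (κ i)] (s : Set X),
      ((M : ℝ≥0∞)⁻¹ • ∑ i, κ i).real s = (M : ℝ)⁻¹ * ∑ i, (κ i).real s := by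
    intro κ _ s
    simp [Measure.real, ENNReal.toReal_sum]
  have hM' : (0 : ℝ) < M := by exact_mod_cast hM
  set β := min α (1 - α)
  have hβ1 : β ≤ α := min_le_left _ _
  have hβ2 : β ≤ 1 - α := min_le_right _ _
  have hβ0 : 0 ≤ β := le_min hα.1.le (by linarith [hα.2])
  -- Subadditivity of the outer measure suffices, so `h` need not be measurable.
  have hc : ∀ i b, 1 ≤ (ν i b).real hᶜ + (ν i b).real h := fun i b => by
    have := measureReal_union_le (μ := ν i b) hᶜ h
    simpa using this
  simp only [Domain.risk, Domain.riskIn, Domain.riskOut, hD, hD', hE, hE', hsum]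
  have key : ∀ i, (if i ∈ J then 0 else 2 * β) ≤
      (1 - α) * (ν i (σ i)).real hᶜ + α * (ν i (!σ i)).real h +
      ((1 - α) * (ν i (τ i)).real hᶜ + α * (ν i (!τ i)).real h) := by
    intro i
    have p1 : ∀ b, 0 ≤ (ν i b).real hᶜ := fun _ => measureReal_nonneg
    have p2 : ∀ b, 0 ≤ (ν i b).real h := fun _ => measureReal_nonneg
    have q1 : ∀ b, β * (ν i b).real hᶜ ≤ (1 - α) * (ν i b).real hᶜ := fun b =>
      mul_le_mul_of_nonneg_right hβ2 (p1 b)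
    have q2 : ∀ b, β * (ν i b).real h ≤ α * (ν i b).real h := fun b =>
      mul_le_mul_of_nonneg_right hβ1 (p2 b)
    split_ifs with hi
    · have r1 : ∀ b, 0 ≤ (1 - α) * (ν i b).real hᶜ := fun b =>
        (mul_nonneg hβ0 (p1 b)).trans (q1 b)
      have r2 : ∀ b, 0 ≤ α * (ν i b).real h := fun b => (mul_nonneg hβ0 (p2 b)).trans (q2 b)
      linarith [r1 (σ i), r2 (!σ i), r1 (τ i), r2 (!τ i)]
    -- Each member of the pair is ID for one domain and OOD for the other, so both `hᶜ` and `h` are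
    -- charged for it.
    · rw [hτ i hi, Bool.not_not]
      have s1 := mul_le_mul_of_nonneg_left (hc i (σ i)) hβ0
      have s2 := mul_le_mul_of_nonneg_left (hc i (!σ i)) hβ0
      linarith [q1 (σ i), q2 (!σ i), q1 (!σ i), q2 (σ i)]
  have hle := Finset.sum_le_sum fun i (_ : i ∈ Finset.univ) => key i
  have hcard : (M : ℝ) * β ≤ ∑ i : Fin M, (if i ∈ J then 0 else 2 * β) := by
    rw [Finset.sum_ite, Finset.sum_const_zero, zero_add, Finset.sum_const, nsmul_eq_mul]
    have h1 : (Finset.univ.filter fun i => i ∉ J) = Jᶜ := by ext; simp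
    rw [h1, Finset.card_compl, Fintype.card_fin, Nat.cast_sub (by omega)]
    have : (2 : ℝ) * J.card ≤ M := by exact_mod_cast hJ
    nlinarith
  simp only [Finset.sum_add_distrib, ← Finset.mul_sum] at hle
  have hfin := mul_le_mul_of_nonneg_left (hcard.trans hle) (inv_nonneg.2 hM'.le)
  rw [inv_mul_cancel_left₀ hM'.ne'] at hfin
  linarith

/-- No uniform learner exists if, for arbitrarily large `M`, each of the `2 ^ M` ways of choosing
one measure from each of `M` pairs gives a domain: the chosen measures make up the ID
distribution and the others the OOD distribution. -/
theorem not_uniformlyLearnable_of_pairs {X : Type*} [TopologicalSpace X] [MeasurableSpace X]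
    [HereditarilyLindelofSpace X] {α : ℝ} (hα : α ∈ Set.Ioo (0 : ℝ) 1) (𝒟 : Set (Domain X))
    (H : ∀ M₀ : ℕ, ∃ M, M₀ ≤ M ∧ 0 < M ∧ ∃ ν : Fin M → Bool → Measure X,
      (∀ i b, IsProbabilityMeasure (ν i b)) ∧
      ∀ σ : Fin M → Bool, ∃ D ∈ 𝒟, D.DisjointSupports ∧
        D.inDist = (M : ℝ≥0∞)⁻¹ • ∑ i, ν i (σ i) ∧
        D.outDist = (M : ℝ≥0∞)⁻¹ • ∑ i, ν i (!σ i)) :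
    ¬ UniformlyLearnable α 𝒟 Set.univ := by
  rintro ⟨N', A, hA⟩
  set β := min α (1 - α)
  have hβ0 : 0 < β := lt_min hα.1 (by linarith [hα.2])
  have hβ1 : 2 * β ≤ 1 := by linarith [min_le_left α (1 - α), min_le_right α (1 - α)]
  -- Two risks of at most `β / 4` cannot add up to `β`.
  have hA := hA (β / 4) ⟨by linarith, by linarith⟩ (1 / 4) ⟨by norm_num, by norm_num⟩
  set N := N' (β / 4) (1 / 4)
  obtain ⟨M, hNM, hM, ν, hν, hσ⟩ := H (2 * N)
  choose D hD𝒟 hDS hDin hDout using hσ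
  set F : (Fin M → Bool) → Set (A.Seed × (Fin N → X)) := fun σ =>
    {p | ∃ h, A.Outputs (β / 4) (1 / 4) p.1 (List.ofFn p.2) h ∧ β / 4 < (D σ).risk α h}
  -- A sample is drawn by first choosing the pair indices `j` uniformly, then drawing from the
  -- chosen members.
  have hF : ∀ σ, (M : ℝ≥0∞)⁻¹ ^ N * ∑ j : Fin N → Fin M,
      (A.seedDist.prod (Measure.pi fun k => ν (j k) (σ (j k)))) (F σ) ≤ 1 / 4 := by
    intro σ
    have h1 := (hA (D σ) (hD𝒟 σ)).2
    simp only [(D σ).iInf_risk_univ_eq_zero hα (hDS σ), zero_add] at h1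
    have h2 := prod_pi_smul_sum (N := N) A.seedDist hM (fun i => ν i (σ i))
    have h4 : (A.seedDist.prod (Measure.pi fun _ : Fin N => (D σ).inDist)) (F σ) =
        (M : ℝ≥0∞)⁻¹ ^ N * ∑ j : Fin N → Fin M,
          (A.seedDist.prod (Measure.pi fun k => ν (j k) (σ (j k)))) (F σ) := by
      simp only [hDin, h2, Measure.smul_apply, Measure.finsetSum_apply, smul_eq_mul]
    rw [← h4]
    refine h1.trans_eq ?_
    rw [ENNReal.ofReal_div_of_pos (by norm_num)]
    simp
  -- `T j` exchanges the roles in the pairs that `j` misses, so the sample law given `j` is the same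
  -- for `σ` and `T j σ`.
  let T : (Fin N → Fin M) → (Fin M → Bool) → (Fin M → Bool) := fun j σ i =>
    if i ∈ Finset.univ.image j then σ i else !σ i
  have hT : ∀ j, Function.Involutive (T j) := by
    intro j σ
    ext i
    simp only [T]
    split_ifs <;> simp
  have hTj : ∀ j σ k, T j σ (j k) = σ (j k) := by
    intro j σ k
    simp [T]
  have hcover : ∀ j σ, F σ ∪ F (T j σ) = Set.univ := by
    intro j σ
    refine Set.eq_univ_of_forall fun p => ?_
    obtain ⟨h, -, hh⟩ := (hA (D σ) (hD𝒟 σ)).1 p.1 p.2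
    have hJ : 2 * (Finset.univ.image j).card ≤ M := by
      have : (Finset.univ.image j).card ≤ N := Finset.card_image_le.trans_eq (by simp)
      omega
    have := sum_risk_lower_bound hα hM ν σ (T j σ) (D σ) (D (T j σ)) (hDin _) (hDout _)
      (hDin _) (hDout _) _ hJ (fun i hi => by simp only [T, if_neg hi]) h
    by_cases h1 : β / 4 < (D σ).risk α h
    · exact Or.inl ⟨h, hh, h1⟩
    · exact Or.inr ⟨h, hh, by linarith⟩
  -- Reindexing by the involution `T j` pairs `F σ` with `F (T j σ)` under one law. They cover the
  -- space, so their outer measures add up to at least `1`.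
  have hpair : ∀ j : Fin N → Fin M, (2 ^ M : ℝ≥0∞) ≤
      2 * ∑ σ, (A.seedDist.prod (Measure.pi fun k => ν (j k) (σ (j k)))) (F σ) := by
    intro j
    have h1 : ∑ σ, (A.seedDist.prod (Measure.pi fun k => ν (j k) (σ (j k)))) (F (T j σ)) =
        ∑ σ, (A.seedDist.prod (Measure.pi fun k => ν (j k) (σ (j k)))) (F σ) := by
      refine Fintype.sum_equiv (hT j).toPerm _ _ fun σ => ?_
      simp [hTj]
    rw [two_mul]
    nth_rewrite 2 [← h1]
    rw [← Finset.sum_add_distrib]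
    calc (2 ^ M : ℝ≥0∞) = ∑ _σ : Fin M → Bool, 1 := by simp
      _ ≤ _ := Finset.sum_le_sum fun σ _ => by
        refine le_trans ?_ (measure_union_le _ _)
        rw [hcover, measure_univ]
  have hMN : (M : ℝ≥0∞)⁻¹ ^ N * M ^ N = 1 := by
    rw [← mul_pow, ENNReal.inv_mul_cancel (by simp [hM.ne']) (by simp), one_pow]
  have hlow : (2 ^ M : ℝ≥0∞) ≤ 2 * ∑ σ, ((M : ℝ≥0∞)⁻¹ ^ N * ∑ j : Fin N → Fin M,
      (A.seedDist.prod (Measure.pi fun k => ν (j k) (σ (j k)))) (F σ)) := by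
    rw [← Finset.mul_sum, Finset.sum_comm, mul_left_comm, Finset.mul_sum]
    calc (2 ^ M : ℝ≥0∞) = (M : ℝ≥0∞)⁻¹ ^ N * ∑ _j : Fin N → Fin M, 2 ^ M := by
          simp only [Finset.sum_const, Finset.card_univ, Fintype.card_pi, Fintype.card_fin,
            Finset.prod_const, nsmul_eq_mul, Nat.cast_pow]
          rw [← mul_assoc, hMN, one_mul]
      _ ≤ _ := by gcongr with j; exact hpair j
  have hup : 2 * ∑ σ, ((M : ℝ≥0∞)⁻¹ ^ N * ∑ j : Fin N → Fin M,
      (A.seedDist.prod (Measure.pi fun k => ν (j k) (σ (j k)))) (F σ)) ≤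
      2 * (2 ^ M * (1 / 4)) := by
    gcongr
    refine (Finset.sum_le_sum fun σ _ => hF σ).trans_eq ?_
    simp
  have := ENNReal.toReal_mono (by finiteness) (hlow.trans hup)
  simp at this
  have h2 : (0 : ℝ) < 2 ^ M := by positivity
  linarith

end Lower

/-! ### Cubic grids and Hölder densities -/

section Grid

variable {n : ℕ}

/-- The index of the cell of the grid of mesh `s` that contains `x`. -/
noncomputable def gridIndex (s : ℝ) (x : EuclideanSpace ℝ (Fin n)) : Fin n → ℤ :=
  fun i => ⌊x i / s⌋

theorem measurable_gridIndex (s : ℝ) : Measurable (gridIndex (n := n) s) := by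
  unfold gridIndex
  fun_prop

theorem volume_gridIndex_preimage {s : ℝ} (hs : 0 < s) (k : Fin n → ℤ) :
    volume (gridIndex s ⁻¹' {k}) = ENNReal.ofReal (s ^ n) := by
  have h : gridIndex s ⁻¹' {k} = (MeasurableEquiv.toLp 2 (Fin n → ℝ)).symm ⁻¹'
      (Set.univ.pi fun i => Set.Ico (k i * s) ((k i + 1) * s)) := by
    ext x
    simp [gridIndex, funext_iff, Int.floor_eq_iff, le_div_iff₀ hs, div_lt_iff₀ hs]
  rw [h, (EuclideanSpace.volume_preserving_symm_measurableEquiv_toLp (Fin n)).measure_preimage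
    (MeasurableSet.univ_pi fun _ => measurableSet_Ico).nullMeasurableSet, volume_pi_pi]
  simp [Real.volume_Ico, add_mul, ENNReal.ofReal_pow hs.le]

theorem dist_le_of_gridIndex_eq {s : ℝ} (hs : 0 < s) {x y : EuclideanSpace ℝ (Fin n)}
    (h : gridIndex s x = gridIndex s y) : dist x y ≤ √n * s := by
  rw [EuclideanSpace.dist_eq]
  have h1 : ∀ i, dist (x i) (y i) ^ 2 ≤ s ^ 2 := by
    intro i
    have h2 := Int.abs_sub_lt_one_of_floor_eq_floor (congrFun h i)
    rw [← sub_div, abs_div, abs_of_pos hs, div_lt_one hs] at h2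
    rw [Real.dist_eq]
    gcongr
  calc _ ≤ √(∑ _i : Fin n, s ^ 2) := Real.sqrt_le_sqrt (Finset.sum_le_sum fun i _ => h1 i)
    _ = √n * s := by simp [Real.sqrt_sq hs.le]

/-- A mesh for which Hölder functions vary by at most `c` on the cells of the grid. -/
theorem exists_mesh (n : ℕ) {γ : ℝ≥0} (C : ℝ≥0) (hγ : 0 < γ) {c : ℝ} (hc : 0 < c) :
    ∃ s : ℝ, 0 < s ∧ √n * s ≤ 1 ∧ C * (√n * s) ^ (γ : ℝ) ≤ c := by
  have h1 : Continuous fun s : ℝ => √n * s := by fun_prop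
  have h2 : Continuous fun s : ℝ => C * (√n * s) ^ (γ : ℝ) :=
    continuous_const.mul (h1.rpow_const fun _ => Or.inr γ.2)
  have e1 := (h1.tendsto 0).eventually_lt_const (u := 1) (by simp)
  have e2 := (h2.tendsto 0).eventually_lt_const (u := c)
    (by simpa [Real.zero_rpow (NNReal.coe_pos.2 hγ).ne'] using hc)
  obtain ⟨s, ⟨h3, h4⟩, h5⟩ := (((e1.and e2).filter_mono nhdsWithin_le_nhds).and
    (self_mem_nhdsWithin (a := (0 : ℝ)) (s := Set.Ioi 0))).exists
  exact ⟨s, h5, h3.le, h4.le⟩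

theorem measure_preimage_le_of_forall_singleton {X ι : Type*} [MeasurableSpace X] [Countable ι]
    [MeasurableSpace ι] [MeasurableSingletonClass ι] {μ ν : Measure X} {φ : X → ι}
    (hφ : Measurable φ) {a : ℝ≥0∞} {K : Set ι}
    (h : ∀ k ∈ K, μ (φ ⁻¹' {k}) ≤ a * ν (φ ⁻¹' {k})) : μ (φ ⁻¹' K) ≤ a * ν (φ ⁻¹' K) := by
  have hK : φ ⁻¹' K = ⋃ k ∈ K, φ ⁻¹' {k} := by ext; simp
  have hd : K.PairwiseDisjoint fun k => φ ⁻¹' {k} := fun i _ j _ hij =>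
    Disjoint.preimage _ (by simpa using hij)
  rw [hK, measure_biUnion K.to_countable hd fun k _ => hφ (measurableSet_singleton k),
    measure_biUnion K.to_countable hd fun k _ => hφ (measurableSet_singleton k),
    ← ENNReal.tsum_mul_left]
  exact ENNReal.tsum_le_tsum fun k => h k k.2

/-- A measure with density at most `c` on the cells of a family, all of which meet the support of
a measure of bounded support, gives the family a mass at most `c` times the volume of a ball. -/
theorem measureReal_gridIndex_preimage_le {R s a : ℝ} (hs : 0 < s) (hs1 : √n * s ≤ 1)
    (ha : 0 ≤ a) {D : Domain (EuclideanSpace ℝ (Fin n))} (hD : D.BoundedID R)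
    {ν : Measure (EuclideanSpace ℝ (Fin n))} {K : Set (Fin n → ℤ)}
    (hK : ∀ k ∈ K, ∃ y ∈ D.inDist.support, gridIndex s y = k)
    (hν : ∀ k ∈ K, ν (gridIndex s ⁻¹' {k}) ≤ ENNReal.ofReal a * volume (gridIndex s ⁻¹' {k})) :
    ν.real (gridIndex s ⁻¹' K) ≤
      a * volume.real (Metric.ball (0 : EuclideanSpace ℝ (Fin n)) (R + 1)) := by
  obtain ⟨y₀, hy₀⟩ := Measure.nonempty_support (NeZero.ne D.inDist)
  -- Cells have diameter at most `√n * s ≤ 1`, which accounts for the `1` in `R + 1`.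
  have hsub : gridIndex s ⁻¹' K ⊆ Metric.ball y₀ (R + 1) := by
    intro x hx
    obtain ⟨y, hy, hyx⟩ := hK _ hx
    have h1 : dist x y ≤ √n * s := dist_le_of_gridIndex_eq hs hyx.symm
    have h2 : edist y y₀ < ENNReal.ofReal R :=
      (Metric.edist_le_ediam_of_mem hy hy₀).trans_lt hD
    rw [edist_dist, ENNReal.ofReal_lt_ofReal_iff_of_nonneg dist_nonneg] at h2
    rw [Metric.mem_ball]
    linarith [dist_triangle x y y₀]
  have h := (measure_preimage_le_of_forall_singleton (measurable_gridIndex s) hν).trans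
    (mul_le_mul_right (measure_mono hsub) _)
  -- Translation invariance removes the dependence on `y₀`, hence on `D`.
  rw [Measure.addHaar_ball_center] at h
  refine (ENNReal.toReal_mono ?_ h).trans_eq ?_
  · exact ENNReal.mul_ne_top ENNReal.ofReal_ne_top measure_ball_lt_top.ne
  · rw [ENNReal.toReal_mul, ENNReal.toReal_ofReal ha]
    rfl

theorem withDensity_le_of_le {X : Type*} [MeasurableSpace X] {μ : Measure X} {f : X → ℝ} {c : ℝ}
    {s : Set X} (hs : MeasurableSet s) (h : ∀ x ∈ s, f x ≤ c) :
    μ.withDensity (fun x => ENNReal.ofReal (f x)) s ≤ ENNReal.ofReal c * μ s := by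
  rw [withDensity_apply _ hs, ← setLIntegral_const]
  exact setLIntegral_mono' hs fun x hx => ENNReal.ofReal_le_ofReal (h x hx)

theorem mem_support_withDensity_of_pos {f : EuclideanSpace ℝ (Fin n) → ℝ} (hf : Continuous f)
    {x : EuclideanSpace ℝ (Fin n)} (hx : 0 < f x) :
    x ∈ (volume.withDensity fun x => ENNReal.ofReal (f x)).support := by
  rw [Measure.mem_support_iff_forall]
  intro U hU
  rw [pos_iff_ne_zero]
  intro h0
  rw [withDensity_apply_eq_zero (by fun_prop)] at h0
  have hmem : {y | ENNReal.ofReal (f y) ≠ 0} ∩ U ∈ nhds x := by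
    refine Filter.inter_mem ?_ hU
    filter_upwards [hf.continuousAt.eventually_const_lt hx] with y hy
    simpa using hy
  exact (Measure.measure_pos_of_mem_nhds volume hmem).ne' h0

end Grid

/-! ### Risk bounds on the grid and the positive result -/

section Upper

variable {n : ℕ} {γ C : ℝ≥0} {R s c : ℝ} {D : Domain (EuclideanSpace ℝ (Fin n))}
  {h : Set (EuclideanSpace ℝ (Fin n))}

/-- Up to a null set, rejected points lie in cells that meet the support and have mass below `3 * c`
times their volume. -/
theorem Domain.riskIn_le_of_grid (hs : 0 < s) (hs1 : √n * s ≤ 1) (hc : 0 < c)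
    (hR : D.BoundedID R)
    (hh : ∀ x ∉ h, D.inDist.real (gridIndex s ⁻¹' {gridIndex s x}) < 3 * (c * s ^ n)) :
    D.riskIn h ≤ 3 * c * volume.real (Metric.ball (0 : EuclideanSpace ℝ (Fin n)) (R + 1)) := by
  set K : Set (Fin n → ℤ) := {k | (∃ y ∈ D.inDist.support, gridIndex s y = k) ∧
    D.inDist.real (gridIndex s ⁻¹' {k}) < 3 * (c * s ^ n)}
  have hsub : hᶜ ⊆ D.inDist.supportᶜ ∪ gridIndex s ⁻¹' K := by
    intro x hx
    by_cases hxs : x ∈ D.inDist.support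
    · exact Or.inr ⟨⟨x, hxs, rfl⟩, hh x hx⟩
    · exact Or.inl hxs
  have h0 : D.inDist.real D.inDist.supportᶜ = 0 := by
    simp [Measure.real]
  have hK := measureReal_gridIndex_preimage_le (ν := D.inDist) (K := K) hs hs1
    (by positivity : 0 ≤ 3 * c) hR (fun k hk => hk.1) (fun k hk => by
      rw [volume_gridIndex_preimage hs, ← ENNReal.ofReal_mul (by positivity),
        ← ofReal_measureReal, mul_assoc]
      exact ENNReal.ofReal_le_ofReal hk.2.le)
  calc D.riskIn h ≤ D.inDist.real (D.inDist.supportᶜ ∪ gridIndex s ⁻¹' K) :=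
        measureReal_mono hsub
    _ ≤ _ := measureReal_union_le _ _
    _ ≤ _ := by rw [h0, zero_add]; exact hK

/-- The mean ID density on an accepted cell exceeds `c`, while the density varies by at most `c`
there; hence it is positive on the whole cell. -/
theorem Domain.IDHolder.riskOut_eq_zero (hD : D.IDHolder γ C) (hγ : 0 < γ)
    (hS : D.DisjointSupports) (hs : 0 < s) (hc : 0 < c)
    (hsC : C * (√n * s) ^ (γ : ℝ) ≤ c)
    (hh : ∀ x ∈ h, c * s ^ n < D.inDist.real (gridIndex s ⁻¹' {gridIndex s x})) :
    D.riskOut h = 0 := by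
  obtain ⟨f, hf0, hf, hfD⟩ := hD
  have hsub : h ⊆ D.inDist.support := by
    intro x hx
    rw [hfD]
    refine mem_support_withDensity_of_pos (hf.continuous hγ) ?_
    obtain ⟨z, hz, hzc⟩ : ∃ z ∈ gridIndex s ⁻¹' {gridIndex s x}, c < f z := by
      by_contra! hcon
      have h1 := withDensity_le_of_le (μ := volume)
        (measurable_gridIndex s (measurableSet_singleton _)) hcon
      rw [← hfD, volume_gridIndex_preimage hs, ← ENNReal.ofReal_mul hc.le,
        ← ofReal_measureReal, ENNReal.ofReal_le_ofReal_iff (by positivity)] at h1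
      exact (hh x hx).not_ge h1
    have h1 := hf.dist_le z x
    have h2 : dist z x ≤ √n * s := dist_le_of_gridIndex_eq hs hz
    have h3 : C * dist z x ^ (γ : ℝ) ≤ C * (√n * s) ^ (γ : ℝ) := by gcongr
    rw [Real.dist_eq] at h1
    linarith [le_abs_self (f z - f x)]
  have h0 : D.outDist h = 0 :=
    measure_mono_null (hsub.trans hS.subset_compl_right) Measure.measure_compl_support
  simp [Domain.riskOut, Measure.real, h0]

/-- An accepted cell has positive ID mass, so it contains a point of the ID support. By DSA the OOD
density vanishes at that point and is at most `c` on the cell. -/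
theorem Domain.OODHolder.riskOut_le (hD : D.OODHolder γ C) (hγ : 0 < γ)
    (hS : D.DisjointSupports) (hR : D.BoundedID R) (hs : 0 < s) (hs1 : √n * s ≤ 1) (hc : 0 < c)
    (hsC : C * (√n * s) ^ (γ : ℝ) ≤ c)
    (hh : ∀ x ∈ h, c * s ^ n < D.inDist.real (gridIndex s ⁻¹' {gridIndex s x})) :
    D.riskOut h ≤ c * volume.real (Metric.ball (0 : EuclideanSpace ℝ (Fin n)) (R + 1)) := by
  obtain ⟨g, hg0, hg, hgD⟩ := hD
  set K : Set (Fin n → ℤ) := {k | ∃ y ∈ D.inDist.support, gridIndex s y = k}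
  have hsub : h ⊆ gridIndex s ⁻¹' K := by
    intro x hx
    have h1 : 0 < D.inDist.real (gridIndex s ⁻¹' {gridIndex s x}) :=
      lt_trans (by positivity) (hh x hx)
    obtain ⟨y, hy, hys⟩ := Measure.nonempty_inter_support_of_pos (ENNReal.toReal_pos_iff.1 h1).1
    exact ⟨y, hys, hy⟩
  refine (measureReal_mono hsub).trans
    (measureReal_gridIndex_preimage_le hs hs1 hc.le hR (fun k hk => hk) ?_)
  rintro _ ⟨y, hy, rfl⟩
  rw [hgD]
  refine withDensity_le_of_le (measurable_gridIndex s (measurableSet_singleton _)) fun z hz => ?_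
  have hgy : g y = 0 := by
    by_contra hne
    have hy' := mem_support_withDensity_of_pos (hg.continuous hγ)
      (lt_of_le_of_ne (hg0 y) (Ne.symm hne))
    rw [← hgD] at hy'
    exact Set.disjoint_left.1 hS hy hy'
  have h1 := hg.dist_le z y
  have h2 : dist z y ≤ √n * s := dist_le_of_gridIndex_eq hs hz
  have h3 : C * dist z y ^ (γ : ℝ) ≤ C * (√n * s) ^ (γ : ℝ) := by gcongr
  rw [Real.dist_eq, hgy, sub_zero] at h1
  linarith [le_abs_self (g z)]

theorem uniformlyLearnable_of_boundedID {α : ℝ} (hα : α ∈ Set.Ioo (0 : ℝ) 1) (hγ : 0 < γ)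
    (hR : 0 < R) (𝒟 : Set (Domain (EuclideanSpace ℝ (Fin n))))
    (hS : ∀ D ∈ 𝒟, D.DisjointSupports) (hB : ∀ D ∈ 𝒟, D.BoundedID R)
    (hH : (∀ D ∈ 𝒟, D.IDHolder γ C) ∨ ∀ D ∈ 𝒟, D.OODHolder γ C) :
    UniformlyLearnable α 𝒟 Set.univ := by
  set V := volume.real (Metric.ball (0 : EuclideanSpace ℝ (Fin n)) (R + 1))
  have hV : 0 < V := ENNReal.toReal_pos
    (Metric.measure_ball_pos _ _ (by linarith)).ne' measure_ball_lt_top.ne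
  have hmesh : ∀ ε : ℝ, ∃ s : ℝ, 0 < s ∧
      (0 < ε → √n * s ≤ 1 ∧ C * (√n * s) ^ (γ : ℝ) ≤ ε / (3 * V)) := by
    intro ε
    by_cases hε : 0 < ε
    · obtain ⟨s, h1, h2, h3⟩ := exists_mesh n C hγ (c := ε / (3 * V)) (by positivity)
      exact ⟨s, h1, fun _ => ⟨h2, h3⟩⟩
    -- An arbitrary mesh for the irrelevant `ε ≤ 0`.
    · exact ⟨1, one_pos, fun h => absurd h hε⟩
  choose s hs hs' using hmesh
  refine uniformlyLearnable_of_partition hα 𝒟 (fun ε => gridIndex (s ε))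
    (fun ε => ε / (3 * V) * s ε ^ n) (fun ε => measurable_gridIndex _)
    (fun ε hε => by have := hs ε; positivity) ?_
  intro ε hε D hD h h1 h2
  have hc : 0 < ε / (3 * V) := by positivity
  -- The `3` in `ε / (3 * V)` offsets the rejection bound `3 * t`.
  have hcV : 3 * (ε / (3 * V)) * V = ε := by field_simp
  have hin := D.riskIn_le_of_grid (hs ε) (hs' ε hε).1 hc (hB D hD) h2
  have hout : D.riskOut h ≤ ε := by
    rcases hH with hH | hH
    · rw [(hH D hD).riskOut_eq_zero hγ (hS D hD) (hs ε) hc (hs' ε hε).2 h1]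
      exact hε.le
    · refine ((hH D hD).riskOut_le hγ (hS D hD) (hB D hD) (hs ε) (hs' ε hε).1 hc
        (hs' ε hε).2 h1).trans ?_
      have : 0 < ε / (3 * V) * V := by positivity
      linarith
  have hin' : D.riskIn h ≤ ε := hin.trans_eq hcV
  have := hα.1
  have := hα.2
  unfold Domain.risk
  nlinarith

end Upper

/-! ### Mixtures of cones with small Hölder constant -/

section Bump

variable {n : ℕ}

/-- The cone of height and radius `1` centred at `p`. -/
noncomputable def cone (p x : EuclideanSpace ℝ (Fin n)) : ℝ := max 0 (1 - dist x p)

theorem cone_nonneg (p x : EuclideanSpace ℝ (Fin n)) : 0 ≤ cone p x := le_max_left _ _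

theorem continuous_cone (p : EuclideanSpace ℝ (Fin n)) : Continuous (cone p) := by
  unfold cone
  fun_prop

theorem cone_eq_zero {p x : EuclideanSpace ℝ (Fin n)} (h : x ∉ Metric.closedBall p 1) :
    cone p x = 0 :=
  max_eq_left (by rw [Metric.mem_closedBall] at h; linarith)

/-- A cone is `1`-Lipschitz with values in `[0, 1]`: for `γ ≤ 1`, the Lipschitz bound serves at
distances up to `1`, the range bound beyond. -/
theorem cone_le_add (p x y : EuclideanSpace ℝ (Fin n)) {γ : ℝ} (hγ : 0 ≤ γ) (hγ1 : γ ≤ 1) :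
    cone p x ≤ cone p y + dist x y ^ γ := by
  rcases le_total 1 (dist x y) with h | h
  · have h1 : cone p x ≤ 1 := max_le zero_le_one (by linarith [dist_nonneg (x := x) (y := p)])
    linarith [Real.one_le_rpow h hγ, cone_nonneg p y]
  · have h1 : dist x y ≤ dist x y ^ γ := by
      simpa using Real.rpow_le_rpow_of_exponent_ge' dist_nonneg h hγ hγ1
    have h2 : 1 - dist y p ≤ cone p y := le_max_right _ _
    refine max_le (add_nonneg (cone_nonneg p y) (by positivity)) ?_
    linarith [dist_triangle y x p, dist_comm x y]

/-- The supports are disjoint, so at most one cone is nonzero at `x`; the Hölder constant does not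
grow with the number of cones. -/
theorem abs_sum_cone_sub_le {ι : Type*} [Fintype ι] {p : ι → EuclideanSpace ℝ (Fin n)}
    (hp : Pairwise fun i j => 2 < dist (p i) (p j)) (x y : EuclideanSpace ℝ (Fin n)) {γ : ℝ}
    (hγ : 0 ≤ γ) (hγ1 : γ ≤ 1) :
    |∑ i, cone (p i) x - ∑ i, cone (p i) y| ≤ dist x y ^ γ := by
  have key : ∀ x y, ∑ i, cone (p i) x ≤ ∑ i, cone (p i) y + dist x y ^ γ := by
    intro x y
    by_cases h : ∃ i, x ∈ Metric.closedBall (p i) 1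
    · obtain ⟨i, hi⟩ := h
      rw [Finset.sum_eq_single_of_mem i (Finset.mem_univ i)]
      · have := Finset.single_le_sum (f := fun i => cone (p i) y)
          (fun j _ => cone_nonneg (p j) y) (Finset.mem_univ i)
        linarith [cone_le_add (p i) x y hγ hγ1]
      · intro j _ hji
        refine cone_eq_zero fun hj => ?_
        rw [Metric.mem_closedBall] at hi hj
        linarith [hp hji, dist_triangle_left (p j) (p i) x]
    · push Not at h
      rw [Finset.sum_eq_zero fun i _ => cone_eq_zero (h i)]
      exact add_nonneg (Finset.sum_nonneg fun i _ => cone_nonneg _ _) (by positivity)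
  rw [abs_le]
  have h1 := key x y
  have h2 := key y x
  rw [dist_comm] at h2
  constructor <;> linarith

theorem hasCompactSupport_cone (p : EuclideanSpace ℝ (Fin n)) : HasCompactSupport (cone p) :=
  HasCompactSupport.intro (isCompact_closedBall p 1) fun _ => cone_eq_zero

/-- The volume under a cone of height and radius `1`. -/
noncomputable def coneVolume (n : ℕ) : ℝ := ∫ x : EuclideanSpace ℝ (Fin n), cone 0 x

theorem coneVolume_pos (n : ℕ) : 0 < coneVolume n :=
  (continuous_cone 0).integral_pos_of_hasCompactSupport_nonneg_nonzero
    (hasCompactSupport_cone 0) (cone_nonneg 0) (x := 0) (by simp [cone])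

theorem integral_cone (p : EuclideanSpace ℝ (Fin n)) : ∫ x, cone p x = coneVolume n := by
  rw [coneVolume, ← integral_sub_right_eq_self (cone 0) p]
  simp [cone, dist_eq_norm]

/-- The probability measure whose density is proportional to a cone. -/
noncomputable def coneMeasure (p : EuclideanSpace ℝ (Fin n)) :
    Measure (EuclideanSpace ℝ (Fin n)) :=
  volume.withDensity fun x => ENNReal.ofReal ((coneVolume n)⁻¹ * cone p x)

instance isProbabilityMeasure_coneMeasure (p : EuclideanSpace ℝ (Fin n)) :
    IsProbabilityMeasure (coneMeasure p) := by
  have hV := coneVolume_pos n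
  refine ⟨?_⟩
  rw [coneMeasure, withDensity_apply _ MeasurableSet.univ, Measure.restrict_univ,
    ← ofReal_integral_eq_lintegral_ofReal, integral_const_mul, integral_cone,
    inv_mul_cancel₀ hV.ne', ENNReal.ofReal_one]
  · exact ((continuous_cone p).integrable_of_hasCompactSupport
      (hasCompactSupport_cone p)).const_mul _
  · exact Filter.Eventually.of_forall fun x =>
      mul_nonneg (inv_nonneg.2 hV.le) (cone_nonneg p x)

theorem coneMeasure_compl_closedBall (p : EuclideanSpace ℝ (Fin n)) :
    coneMeasure p (Metric.closedBall p 1)ᶜ = 0 := by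
  have h := withDensity_le_of_le (μ := volume) (f := fun x => (coneVolume n)⁻¹ * cone p x)
    (c := 0) (Metric.isClosed_closedBall (x := p) (ε := 1)).measurableSet.compl
    (fun x hx => by simp [cone_eq_zero hx])
  simpa [coneMeasure] using h

variable {M : ℕ}

theorem smul_sum_coneMeasure (hM : 0 < M) (p : Fin M → EuclideanSpace ℝ (Fin n)) :
    (M : ℝ≥0∞)⁻¹ • ∑ i, coneMeasure (p i) = volume.withDensity fun x =>
      ENNReal.ofReal ((M * coneVolume n)⁻¹ * ∑ i, cone (p i) x) := by
  have hV := coneVolume_pos n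
  have hm : ∀ i, Measurable fun x => ENNReal.ofReal ((coneVolume n)⁻¹ * cone (p i) x) :=
    fun i => ((continuous_cone (p i)).measurable.const_mul _).ennreal_ofReal
  ext s hs
  rw [withDensity_apply _ hs, Measure.smul_apply, Measure.finsetSum_apply, smul_eq_mul]
  simp only [coneMeasure, withDensity_apply _ hs]
  rw [← lintegral_finsetSum _ fun i _ => hm i,
    ← lintegral_const_mul _ (Finset.measurable_fun_sum _ fun i _ => hm i)]
  congr 1
  ext x
  have hM' : (0 : ℝ) < M := by exact_mod_cast hM
  rw [← ENNReal.ofReal_sum_of_nonneg fun i _ =>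
      mul_nonneg (inv_nonneg.2 hV.le) (cone_nonneg (p i) x),
    ← Finset.mul_sum, ← ENNReal.ofReal_natCast, ← ENNReal.ofReal_inv_of_pos hM',
    ← ENNReal.ofReal_mul (by positivity), mul_inv, mul_assoc]

theorem hasHolderDensity_smul_sum_coneMeasure {γ C : ℝ≥0} (hγ : γ ≤ 1) (hM : 0 < M)
    (hMC : (M * coneVolume n)⁻¹ ≤ C) {p : Fin M → EuclideanSpace ℝ (Fin n)}
    (hp : Pairwise fun i j => 2 < dist (p i) (p j)) :
    HasHolderDensity γ C ((M : ℝ≥0∞)⁻¹ • ∑ i, coneMeasure (p i)) := by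
  have hV := coneVolume_pos n
  refine ⟨fun x => (M * coneVolume n)⁻¹ * ∑ i, cone (p i) x, fun x => ?_, fun x y => ?_,
    smul_sum_coneMeasure hM p⟩
  · exact mul_nonneg (by positivity) (Finset.sum_nonneg fun i _ => cone_nonneg _ _)
  · rw [edist_dist, edist_dist, ENNReal.ofReal_rpow_of_nonneg dist_nonneg γ.coe_nonneg,
      ← ENNReal.ofReal_coe_nnreal, ← ENNReal.ofReal_mul C.coe_nonneg]
    refine ENNReal.ofReal_le_ofReal ?_
    rw [Real.dist_eq, ← mul_sub, abs_mul, abs_of_nonneg (by positivity)]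
    exact mul_le_mul hMC (abs_sum_cone_sub_le hp x y γ.2 hγ) (abs_nonneg _) C.2

theorem support_smul_sum_coneMeasure_subset (p : Fin M → EuclideanSpace ℝ (Fin n)) :
    ((M : ℝ≥0∞)⁻¹ • ∑ i, coneMeasure (p i)).support ⊆ ⋃ i, Metric.closedBall (p i) 1 := by
  refine Measure.support_subset_of_isClosed
    (isClosed_iUnion_of_finite fun i => Metric.isClosed_closedBall) ?_
  rw [mem_ae_iff, Measure.smul_apply, Measure.finsetSum_apply, smul_eq_mul,
    Finset.sum_eq_zero, mul_zero]
  intro i _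
  exact measure_mono_null (Set.compl_subset_compl.2 (Set.subset_iUnion_of_subset i subset_rfl))
    (coneMeasure_compl_closedBall (p i))

theorem isProbabilityMeasure_smul_sum {X : Type*} [MeasurableSpace X] (hM : 0 < M)
    (ν : Fin M → Measure X) [∀ i, IsProbabilityMeasure (ν i)] :
    IsProbabilityMeasure ((M : ℝ≥0∞)⁻¹ • ∑ i, ν i) := by
  constructor
  rw [Measure.smul_apply, Measure.finsetSum_apply]
  simp [ENNReal.inv_mul_cancel, hM.ne']

end Bump

/-! ### The negative result -/

section Lower

variable {n : ℕ}

/-- Two sequences of points on a line, such that distinct points have distance at least `3`. -/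
noncomputable def center (hn : 1 ≤ n) (i : ℕ) (b : Bool) : EuclideanSpace ℝ (Fin n) :=
  EuclideanSpace.single ⟨0, hn⟩ (3 * ((2 * i + b.toNat : ℕ) : ℝ))

theorem two_lt_dist_center (hn : 1 ≤ n) {i j : ℕ} {b b' : Bool} (h : (i, b) ≠ (j, b')) :
    2 < dist (center hn i b) (center hn j b') := by
  have hne : ((2 * i + b.toNat : ℕ) : ℤ) - (2 * j + b'.toNat : ℕ) ≠ 0 := by
    intro h0
    apply h
    cases b <;> cases b' <;> simp at h0 ⊢ <;> omega
  have h1 : (1 : ℝ) ≤ |((2 * i + b.toNat : ℕ) : ℝ) - (2 * j + b'.toNat : ℕ)| := by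
    exact_mod_cast Int.one_le_abs hne
  rw [center, center, PiLp.dist_single_same, Real.dist_eq, ← mul_sub, abs_mul,
    abs_of_pos (by norm_num : (0 : ℝ) < 3)]
  linarith

/-- ID and OOD distributions are both cone mixtures, so one family of domains lies in both Hölder
spaces and settles both claims. -/
theorem not_uniformlyLearnable_of_idHolder_oodHolder (hn : 1 ≤ n) {γ C : ℝ≥0} (hγ : γ ≤ 1)
    (hC : 0 < C) {α : ℝ} (hα : α ∈ Set.Ioo (0 : ℝ) 1)
    {𝒟 : Set (Domain (EuclideanSpace ℝ (Fin n)))}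
    (h𝒟 : idHolderSpace n γ C ∩ oodHolderSpace n γ C ⊆ 𝒟) :
    ¬ UniformlyLearnable α 𝒟 Set.univ := by
  refine not_uniformlyLearnable_of_pairs hα 𝒟 fun M₀ => ?_
  have hV := coneVolume_pos n
  have hC' : (0 : ℝ) < C := hC
  -- The last term brings the Hölder constant `(M * coneVolume n)⁻¹` down to `C`.
  set M := max (max M₀ 1) ⌈(C * coneVolume n)⁻¹⌉₊
  have hM0 : M₀ ≤ M := (le_max_left _ _).trans (le_max_left _ _)
  have hM : 0 < M := Nat.lt_of_lt_of_le one_pos ((le_max_right _ _).trans (le_max_left _ _))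
  have hMC : ((M : ℝ) * coneVolume n)⁻¹ ≤ C := by
    have h1 : (C * coneVolume n)⁻¹ ≤ (M : ℝ) :=
      (Nat.le_ceil _).trans (by exact_mod_cast le_max_right _ _)
    have hM' : (0 : ℝ) < M := by exact_mod_cast hM
    rw [inv_le_iff_one_le_mul₀ (by positivity)] at h1 ⊢
    linarith
  have hsep : ∀ σ : Fin M → Bool,
      Pairwise fun i j : Fin M => 2 < dist (center hn i (σ i)) (center hn j (σ j)) :=
    fun σ i j hij => two_lt_dist_center hn fun h => hij (Fin.ext (Prod.ext_iff.1 h).1)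
  refine ⟨M, hM0, hM, fun i b => coneMeasure (center hn i b), fun i b => inferInstance,
    fun σ => ?_⟩
  let D : Domain (EuclideanSpace ℝ (Fin n)) :=
    { inDist := (M : ℝ≥0∞)⁻¹ • ∑ i : Fin M, coneMeasure (center hn i (σ i))
      outDist := (M : ℝ≥0∞)⁻¹ • ∑ i : Fin M, coneMeasure (center hn i (!σ i))
      isProb_in := isProbabilityMeasure_smul_sum hM _
      isProb_out := isProbabilityMeasure_smul_sum hM _ }
  have hD : D.DisjointSupports := by
    refine Set.disjoint_left.2 fun x hx hx' => ?_
    obtain ⟨i, hi⟩ := Set.mem_iUnion.1 (support_smul_sum_coneMeasure_subset _ hx)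
    obtain ⟨j, hj⟩ := Set.mem_iUnion.1 (support_smul_sum_coneMeasure_subset _ hx')
    rw [Metric.mem_closedBall] at hi hj
    have h1 : ((i : ℕ), σ i) ≠ ((j : ℕ), !σ j) := by
      intro h
      obtain ⟨h1, h2⟩ := Prod.ext_iff.1 h
      obtain rfl : i = j := Fin.ext h1
      simp at h2
    linarith [two_lt_dist_center hn h1,
      dist_triangle_left (center hn i (σ i)) (center hn j (!σ j)) x]
  exact ⟨D, h𝒟 ⟨⟨hD, hasHolderDensity_smul_sum_coneMeasure hγ hM hMC (hsep σ)⟩,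
    ⟨hD, hasHolderDensity_smul_sum_coneMeasure hγ hM hMC (hsep fun i => !σ i)⟩⟩, hD, rfl, rfl⟩

end Lower

end OODDetection

theorem mainTheorem7 (n : ℕ) (α : ℝ) (hα : α ∈ Set.Ioo (0 : ℝ) 1) (γ C : ℝ≥0) (hγ : 0 < γ) :
    (∀ R : ℝ, 0 < R → ∀ 𝒟 : Set (OODDetection.Domain (EuclideanSpace ℝ (Fin n))),
      (∀ D ∈ 𝒟, D.DisjointSupports) →
      (∀ D ∈ 𝒟, D.BoundedID R) →
      ((∀ D ∈ 𝒟, D.IDHolder γ C) ∨ (∀ D ∈ 𝒟, D.OODHolder γ C)) →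
      OODDetection.UniformlyLearnable α 𝒟 Set.univ) ∧
    (1 ≤ n → γ ≤ 1 → 0 < C →
      ¬ OODDetection.UniformlyLearnable α (OODDetection.idHolderSpace n γ C) Set.univ ∧
      ¬ OODDetection.UniformlyLearnable α (OODDetection.oodHolderSpace n γ C) Set.univ) :=
  ⟨fun _ hR 𝒟 hS hB hH => OODDetection.uniformlyLearnable_of_boundedID hα hγ hR 𝒟 hS hB hH,
    fun hn hγ1 hC =>
      ⟨OODDetection.not_uniformlyLearnable_of_idHolder_oodHolder hn hγ1 hC hα
        Set.inter_subset_left,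
      OODDetection.not_uniformlyLearnable_of_idHolder_oodHolder hn hγ1 hC hα
        Set.inter_subset_right⟩⟩
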